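/- Let $d=(d_1\ge d_2\ge\cdots\ge d_\ell>0)$ be a partition of $N$ with $d\neq(N)$ and $d\ne(1,\ldots,1)$ (so $N\ge 3$), and put $h=d_1+\ell-1$, its maximal hook length. Let $\tau$ be the irreducible representation of the symmetric group $\mathcal S_N$ labelled by $d$ (one-row partitions label the trivial representations), realized by real orthogonal $n\times n$ matrices, acting on $V=\mathbb C^n$ with its standard Hermitian inner product. Let $-1/h<\kappa<1/h$ be real. On the torus $\mathbb T^N=\{x\in\mathbb C^N: |x_1|=\dots=|x_N|=1\}$, $x_j=e^{\mathrm i\theta_j}$, write $x_i\partial_i=-\mathrm i\,\partial/\partial\theta_i$, let $(xw)_i=x_{w(i)}$ for $w\in\mathcal S_N$, and for $f\in C^{1}(\mathbb T^N;V)$ let $$x_i\mathcal D_i f(x)=x_i\partial_i f(x)+\kappa\sum_{j\neq i}\tau((i,j))\,x_i\,\frac{f(x)-f(x(i,j))}{x_i-x_j},$$ where for $x_i=x_j$ the term $x_i\frac{f(x)-f(x(i,j))}{x_i-x_j}$ is understood as its limit value $x_i\partial_i f(x)-x_j\partial_j f(x)$. Let $\mu$ be an orthogonality measure for the vector-valued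 nonsymmetric Jack polynomials attached to $\tau$ and $\kappa$, that is, a countably additive measure on the Borel sets of $\mathbb T^N$ whose values are positive semidefinite Hermitian $n\times n$ matrices, such that for all $f,g\in C^{1}(\mathbb T^N;V)$, $w\in\mathcal S_N$, $1\le i\le N$ and $u,v\in V$ $$\int f(x)^*\,\mathrm d\mu(x)\,g(x)=\int f(xw)^*\tau(w)^{-1}\,\mathrm d\mu(x)\,\tau(w)g(xw),$$ $$\int (x_i\mathcal D_i f(x))^*\,\mathrm d\mu(x)\,g(x)=\int f(x)^*\,\mathrm d\mu(x)\,x_i\mathcal D_i g(x),\qquad \int u^*\,\mathrm d\mu(x)\,v=u^*v .$$ Let $\mu_S$, the singular part of $\mu$, be the restriction of $\mu$ to $\bigcup_{i<j}\{x\in\mathbb T^N: x_i=x_j\}$. For $i<j$ let $T_{i,j}$ be the set of $x\in\mathbb T^N$ with $x_i=x_j$ and $x_k\neq x_l$ for every other pair $k\ne l$, $\{k,l\}\neq\{i,j\}$ (that is, $x_i=x_j$ and $\#\{x_k\}=N-1$). Then for all $1\le i<j\le N$ the restriction $\mu_S|_{T_{i,j}}$ is $0$. Consequently $\mu_S$ is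 supported by the set $\{x\in\mathbb T^N:\#\{x_1,\ldots,x_N\}\le N-2\}$ of points with at most $N-2$ distinct coordinates, i.e. $\mu_S(B)=0$ for every Borel set $B$ disjoint from it. -/

import Mathlib

/-- The Borel σ-algebra on the unit circle. -/
noncomputable instance JackTorus.instMeasurableSpaceCircle : MeasurableSpace Circle := borel Circle

instance JackTorus.instBorelSpaceCircle : BorelSpace Circle := ⟨rfl⟩

namespace JackTorus

section Representation

/-- The Young symmetrizer of a tableau `t` (a filling of the boxes of the Young diagram `d` with the
`N` entries): the row symmetrizer times the column antisymmetrizer. -/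
noncomputable def youngSymmetrizer {N : ℕ} {d : YoungDiagram} (t : Fin N ≃ d.cells) :
    MonoidAlgebra ℝ (Equiv.Perm (Fin N)) :=
  (∑ w : Equiv.Perm (Fin N) with ∀ k, (t (w k)).1.1 = (t k).1.1,
      MonoidAlgebra.single w (1 : ℝ)) *
  (∑ w : Equiv.Perm (Fin N) with ∀ k, (t (w k)).1.2 = (t k).1.2,
      MonoidAlgebra.single w ((Equiv.Perm.sign w : ℤ) : ℝ))

/-- The Specht module: the left ideal of the group algebra `ℝ[S_N]` generated by the Young
symmetrizer. -/
noncomputable def spechtModule {N : ℕ} {d : YoungDiagram} (t : Fin N ≃ d.cells) :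
    Submodule (MonoidAlgebra ℝ (Equiv.Perm (Fin N))) (MonoidAlgebra ℝ (Equiv.Perm (Fin N))) :=
  Submodule.span _ {youngSymmetrizer t}

/-- The orthogonal matrix representation `τ` of `S_N` is a realization, in an orthonormal basis
indexed by `ι`, of the irreducible representation labelled by the Young diagram `d`
(the one-row diagram labels the trivial and the one-column diagram the sign representation).
The existence of `t` forces `d` to have `N` boxes. -/
def IsOfShape {N : ℕ} {ι : Type*} [Fintype ι] [DecidableEq ι]
    (τ : Equiv.Perm (Fin N) →* Matrix.orthogonalGroup ι ℝ) (d : YoungDiagram) : Prop :=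
  ∃ (t : Fin N ≃ d.cells) (φ : spechtModule t ≃ₗ[ℝ] (ι → ℝ)),
    ∀ (w : Equiv.Perm (Fin N)) (v : spechtModule t),
      φ ((MonoidAlgebra.single w (1 : ℝ) : MonoidAlgebra ℝ (Equiv.Perm (Fin N))) • v) =
        (τ w : Matrix ι ι ℝ).mulVec (φ v)

/-- The maximal hook length `h = d₁ + ℓ(d) - 1` of a (nonempty) diagram, as a real number. -/
noncomputable def maxHook (d : YoungDiagram) : ℝ := (d.rowLen 0 : ℝ) + (d.colLen 0 : ℝ) - 1

/-- The matrix of `τ(w)` acting on the complex space `V = ℂ^ι`. -/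
noncomputable def repMatrix {N : ℕ} {ι : Type*} [Fintype ι] [DecidableEq ι]
    (τ : Equiv.Perm (Fin N) →* Matrix.orthogonalGroup ι ℝ) (w : Equiv.Perm (Fin N)) :
    Matrix ι ι ℂ :=
  (τ w : Matrix ι ι ℝ).map Complex.ofReal

end Representation

section Functions

/-- The torus `𝕋^N`. -/
abbrev Torus (N : ℕ) : Type := Fin N → Circle

/-- `f` is of class `C¹` on the torus: its lift `θ ↦ f(e^{iθ₁}, …, e^{iθ_N})` is of class `C¹`. -/
def IsC1 {N : ℕ} {ι : Type*} [Fintype ι] (f : Torus N → (ι → ℂ)) : Prop :=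
  ContDiff ℝ 1 (fun θ : Fin N → ℝ => f (fun i => Circle.exp (θ i)))

/-- The operator `x_i ∂_i = -√-1 ∂/∂θ_i` on functions on the torus (`x_i = e^{√-1 θ_i}`). -/
noncomputable def eulerDeriv {N : ℕ} {ι : Type*} [Fintype ι] (i : Fin N)
    (f : Torus N → (ι → ℂ)) (x : Torus N) : ι → ℂ :=
  (-Complex.I) • deriv (fun t : ℝ => f (Function.update x i (x i * Circle.exp t))) 0

open Classical in
/-- `x_i (f(x) - f(x(i,j))) / (x_i - x_j)`, where `x(i,j)` is `x` with coordinates `i` and `j`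
interchanged; on the mirror `x_i = x_j` the quotient is given its limit value, which for a `C¹`
function is `x_i ∂_i f - x_j ∂_j f`. -/
noncomputable def dividedDiff {N : ℕ} {ι : Type*} [Fintype ι] (i j : Fin N)
    (f : Torus N → (ι → ℂ)) (x : Torus N) : ι → ℂ :=
  if x i = x j then eulerDeriv i f x - eulerDeriv j f x
  else ((x i : ℂ) / ((x i : ℂ) - (x j : ℂ))) • (f x - f (x ∘ Equiv.swap i j))

/-- The operator `x_i D_i`, where
`D_i f(x) = ∂_i f(x) + κ ∑_{j ≠ i} τ((i,j)) (f(x) - f(x(i,j))) / (x_i - x_j)`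
is the Dunkl operator. -/
noncomputable def xDunkl {N : ℕ} {ι : Type*} [Fintype ι] [DecidableEq ι]
    (τ : Equiv.Perm (Fin N) →* Matrix.orthogonalGroup ι ℝ) (κ : ℝ) (i : Fin N)
    (f : Torus N → (ι → ℂ)) (x : Torus N) : ι → ℂ :=
  eulerDeriv i f x +
    (κ : ℂ) • ∑ j ∈ Finset.univ.erase i,
      (repMatrix τ (Equiv.swap i j)).mulVec (dividedDiff i j f x)

/-- The action `(w f)(x) = τ(w) f(xw)` of `S_N`, where `(xw)_i = x_{w(i)}`. -/
noncomputable def permAct {N : ℕ} {ι : Type*} [Fintype ι] [DecidableEq ι]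
    (τ : Equiv.Perm (Fin N) →* Matrix.orthogonalGroup ι ℝ) (w : Equiv.Perm (Fin N))
    (f : Torus N → (ι → ℂ)) (x : Torus N) : ι → ℂ :=
  (repMatrix τ w).mulVec (f (x ∘ w))

end Functions

section Measures

open MeasureTheory
open scoped ComplexOrder

/-- The `(a,b)` entry of a matrix-valued measure, a complex measure. -/
noncomputable def entryMeasure {N : ℕ} {ι : Type*}
    (μ : VectorMeasure (Torus N) (Matrix ι ι ℂ)) (a b : ι) : ComplexMeasure (Torus N) :=
  μ.mapRange (Matrix.entryAddMonoidHom ℂ a b) (continuous_id.matrix_elem a b)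

/-- `∫ f(x)^* dμ(x) g(x) = ∑_{a,b} ∫ conj(f_a(x)) g_b(x) dμ_{a,b}(x)`. -/
noncomputable def sesqInt {N : ℕ} {ι : Type*} [Fintype ι]
    (μ : VectorMeasure (Torus N) (Matrix ι ι ℂ)) (f g : Torus N → (ι → ℂ)) : ℂ :=
  ∑ a, ∑ b, (entryMeasure μ a b).integral
    (fun x => (starRingEnd ℂ) (f x a) * g x b) (ContinuousLinearMap.mul ℝ ℂ)

/-- `μ` is an orthogonality measure on the torus for the vector-valued nonsymmetric Jack
polynomials with representation `τ` and parameter `κ`. -/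
structure IsOrthogonalityMeasure {N : ℕ} {ι : Type*} [Fintype ι] [DecidableEq ι]
    (τ : Equiv.Perm (Fin N) →* Matrix.orthogonalGroup ι ℝ) (κ : ℝ)
    (μ : VectorMeasure (Torus N) (Matrix ι ι ℂ)) : Prop where
  /-- the values of `μ` are positive semidefinite Hermitian matrices -/
  pos : ∀ B : Set (Torus N), MeasurableSet B → (μ B).PosSemidef
  /-- `⟨wf, wg⟩ = ⟨f, g⟩` -/
  invariant : ∀ (w : Equiv.Perm (Fin N)) (f g : Torus N → (ι → ℂ)), IsC1 f → IsC1 g →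
    sesqInt μ f g = sesqInt μ (permAct τ w f) (permAct τ w g)
  /-- `⟨x_i D_i f, g⟩ = ⟨f, x_i D_i g⟩` -/
  symmetric : ∀ (i : Fin N) (f g : Torus N → (ι → ℂ)), IsC1 f → IsC1 g →
    sesqInt μ (xDunkl τ κ i f) g = sesqInt μ f (xDunkl τ κ i g)
  /-- `⟨1 ⊗ u, 1 ⊗ v⟩` is the inner product of `u` and `v` -/
  normalized : ∀ u v : ι → ℂ,
    sesqInt μ (fun _ => u) (fun _ => v) = ∑ a, (starRingEnd ℂ) (u a) * v a

/-- The singular set `𝕋^N ∖ 𝕋^N_reg = ⋃_{i<j} {x | x_i = x_j}`. -/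
def singularSet (N : ℕ) : Set (Torus N) := ⋃ (i : Fin N) (j : Fin N) (_ : i < j), {x | x i = x j}

lemma measurableSet_singularSet (N : ℕ) : MeasurableSet (singularSet N) :=
  MeasurableSet.iUnion fun i => MeasurableSet.iUnion fun j => MeasurableSet.iUnion fun _ =>
    (isClosed_eq (continuous_apply i) (continuous_apply j)).measurableSet

/-- The singular part `μ_S` of `μ`: the restriction of `μ` to `𝕋^N ∖ 𝕋^N_reg`. -/
noncomputable def singularPart {N : ℕ} {ι : Type*}
    (μ : VectorMeasure (Torus N) (Matrix ι ι ℂ)) : VectorMeasure (Torus N) (Matrix ι ι ℂ) :=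
  μ.restrict (singularSet N)

/-- `T_{i,j}`: the points with `x_i = x_j` and no other coincidence among the coordinates. -/
def face {N : ℕ} (i j : Fin N) : Set (Torus N) :=
  {x | x i = x j ∧ ∀ k l : Fin N, k ≠ l → s(k, l) ≠ s(i, j) → x k ≠ x l}

lemma measurableSet_face {N : ℕ} (i j : Fin N) : MeasurableSet (face i j) := by
  have h : face i j = {x : Torus N | x i = x j} ∩
      ⋂ (k : Fin N) (l : Fin N) (_ : k ≠ l) (_ : s(k, l) ≠ s(i, j)),
        {x : Torus N | x k = x l}ᶜ := by
    ext x
    simp [face]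
  rw [h]
  refine (isClosed_eq (continuous_apply i) (continuous_apply j)).measurableSet.inter ?_
  exact MeasurableSet.iInter fun k => MeasurableSet.iInter fun l => MeasurableSet.iInter fun _ =>
    MeasurableSet.iInter fun _ =>
      (isClosed_eq (continuous_apply k) (continuous_apply l)).measurableSet.compl

/-- `ν` is supported by `S`: it vanishes on every Borel set disjoint from `S`. -/
def SupportedBy {N : ℕ} {ι : Type*} (ν : VectorMeasure (Torus N) (Matrix ι ι ℂ))
    (S : Set (Torus N)) : Prop :=
  ∀ B : Set (Torus N), MeasurableSet B → Disjoint B S → ν B = 0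

end Measures

end JackTorus

/-! ### Integration against positive semidefinite matrix-valued measures. -/

namespace JackTorus

open MeasureTheory Filter Topology
open scoped ComplexOrder ENNReal

/-! Constant functions are annihilated by `xDunkl`, so symmetry makes the integral of `xDunkl τ κ i
f` against any constant vector vanish for every `C¹` function `f`. This is applied to `f = φ_n • v`
with `φ_n = mirrorBump i j n`, the product of a weight `W` and `spike n (x i / x j)`. The spikes
tend to `0` while their derivative at `1` stays equal to `1`. The weight kills the contributions of
the other mirrors. By `boundedTendsto_xDunkl_mirrorBump`, with `σ = τ((i,j))`, the functions `xDunkl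
τ κ i (φ_n • v)` converge boundedly to `-√-1 W · (v + 2κ σ v)` on `x_i = x_j` and to `0` elsewhere.

Since `σ² = 1`, the choice `v = e_a - 2κ σ e_a` turns `v + 2κ σ v` into `(1 - 4κ²) e_a`. The maximal
hook length is at least `3`, so `|2κ| < 1` and this scalar is nonzero. Dominated convergence then
shows that `W` has integral `0` over the mirror for the diagonal entry `μ_aa`, a positive measure.
As `W > 0` on the face, every diagonal entry of `μ` vanishes there, and positivity gives the whole
matrix. The statement on supports follows because a singular point with at least `N - 1` distinct
coordinates lies on a face. -/

/-- A complex measure has finite total variation. -/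
instance isFiniteMeasure_variation_complexMeasure {X : Type*} [MeasurableSpace X]
    (c : ComplexMeasure X) : IsFiniteMeasure c.variation := by
  have hle : c.variation ≤ (ComplexMeasure.re c).totalVariation +
      (ComplexMeasure.im c).totalVariation := by
    refine VectorMeasure.variation_le_of_forall_enorm_le fun E _ => ?_
    have h₁ := SignedMeasure.enorm_le_totalVariation (ComplexMeasure.re c) E
    have h₂ := SignedMeasure.enorm_le_totalVariation (ComplexMeasure.im c) E
    have h₃ : ‖c E‖ₑ ≤ ‖(c E).re‖ₑ + ‖(c E).im‖ₑ := by
      rw [← ofReal_norm, ← ofReal_norm, ← ofReal_norm, ← ENNReal.ofReal_add (norm_nonneg _)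
        (norm_nonneg _)]
      exact ENNReal.ofReal_le_ofReal (Complex.norm_le_abs_re_add_abs_im _)
    exact h₃.trans (add_le_add h₁ h₂)
  have : IsFiniteMeasure ((ComplexMeasure.re c).totalVariation +
      (ComplexMeasure.im c).totalVariation) := by
    unfold SignedMeasure.totalVariation
    infer_instance
  exact isFiniteMeasure_of_le _ hle

/-- The integral against a complex measure with nonnegative real values is the integral against
the corresponding positive measure. -/
lemma integral_complexMeasure_eq {X : Type*} [MeasurableSpace X] (c : ComplexMeasure X)
    (m : Measure X) [IsFiniteMeasure m] (hc : ∀ B, MeasurableSet B → c B = (m.real B : ℂ))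
    {f : X → ℂ} (hf : Integrable f m) :
    c.integral f (ContinuousLinearMap.mul ℝ ℂ) = ∫ x, f x ∂m := by
  -- Both integrals are `setToFun` extensions of set functions that agree on measurable sets.
  -- Domination of the variation by `m` lets the reference measure be exchanged.
  have hle : c.variation ≤ (1 : ℝ≥0∞) • m := by
    rw [one_smul]
    refine VectorMeasure.variation_le_of_forall_enorm_le fun E hE => ?_
    rw [hc E hE, ← ofReal_norm, Complex.norm_real, Real.norm_of_nonneg measureReal_nonneg]
    simp
  have hT : ∀ s, MeasurableSet s →
      c.transpose (ContinuousLinearMap.mul ℝ ℂ) s = (weightedSMul m s : ℂ →L[ℝ] ℂ) := by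
    intro s hs
    ext x
    simp [transpose_eq_cbmApplyMeasure, hc s hs, weightedSMul_apply, mul_comm]
  have hd := dominatedFinMeasAdditive_cbmApplyMeasure c (ContinuousLinearMap.mul ℝ ℂ)
  have hd' := hd.of_measure_le (by simpa using hle) (ContinuousLinearMap.opNorm_nonneg _)
  rw [VectorMeasure.integral_eq_setToFun, integral_eq_setToFun,
    ← setToFun_congr_measure_of_integrable 1 ENNReal.one_ne_top hle hd' hd f hf]
  exact setToFun_congr_left' _ _ (fun s hs _ => hT s hs) f

/-- The diagonal entries of a positive semidefinite matrix-valued measure are finite positive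
measures. -/
lemma exists_diagonal_measure {N : ℕ} {ι : Type*}
    (μ : VectorMeasure (Torus N) (Matrix ι ι ℂ))
    (hpos : ∀ B : Set (Torus N), MeasurableSet B → (μ B).PosSemidef) (a : ι) :
    ∃ m : Measure (Torus N), IsFiniteMeasure m ∧
      ∀ B, MeasurableSet B → μ B a a = (m.real B : ℂ) := by
  set s := ComplexMeasure.re (entryMeasure μ a a) with hs
  have hval : ∀ B, s B = (μ B a a).re := fun B => rfl
  have hnn : 0 ≤[Set.univ] s := by
    rw [VectorMeasure.le_restrict_univ_iff_le]
    intro B hB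
    rw [hval]
    exact (Complex.nonneg_iff.1 (hpos B hB).diag_nonneg).1
  refine ⟨s.toMeasureOfZeroLE Set.univ MeasurableSet.univ hnn, inferInstance, fun B hB => ?_⟩
  have h0 := Complex.nonneg_iff.1 ((hpos B hB).diag_nonneg (i := a))
  have h1 : (s.toMeasureOfZeroLE Set.univ MeasurableSet.univ hnn).real B = s B := by
    rw [Measure.real, SignedMeasure.toMeasureOfZeroLE_apply s hnn MeasurableSet.univ hB,
      ENNReal.coe_toReal]
    exact congrArg s (Set.univ_inter B)
  rw [h1, hval]
  exact Complex.ext rfl h0.2.symm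

/-- Dominated convergence for the sesquilinear integral in its first argument. -/
lemma tendsto_sesqInt_const {N : ℕ} {ι : Type*} [Fintype ι]
    (μ : VectorMeasure (Torus N) (Matrix ι ι ℂ)) {F : ℕ → Torus N → (ι → ℂ)}
    {L : Torus N → (ι → ℂ)} (u : ι → ℂ) (hmeas : ∀ n, Measurable (F n)) {C : ℝ}
    (hC : ∀ n x, ‖F n x‖ ≤ C) (hL : ∀ x, Tendsto (fun n => F n x) atTop (𝓝 (L x))) :
    Tendsto (fun n => sesqInt μ (F n) (fun _ => u)) atTop (𝓝 (sesqInt μ L fun _ => u)) := by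
  refine tendsto_finsetSum _ fun a _ => tendsto_finsetSum _ fun b _ => ?_
  refine VectorMeasure.tendsto_integral_filter_of_norm_le_const (.of_forall fun n => ?_)
    ⟨C * ‖u b‖, .of_forall fun n => .of_forall fun x => ?_⟩ (.of_forall fun x => ?_)
  · have : Measurable fun x => F n x a := (measurable_pi_apply a).comp (hmeas n)
    exact ((Complex.continuous_conj.measurable.comp this).mul_const _).aestronglyMeasurable
  · rw [norm_mul, RCLike.norm_conj]
    gcongr
    exact (norm_le_pi_norm _ a).trans (hC n x)
  · exact (((Complex.continuous_conj.tendsto _).comp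
      ((tendsto_pi_nhds.1 (hL x)) a))).mul_const _

end JackTorus


namespace JackTorus

open MeasureTheory Filter Topology

/-! ### Angular derivatives through the lift to `ℝ^N`. -/

section AngularDerivative

variable {N : ℕ} {E : Type*} [NormedAddCommGroup E] [NormedSpace ℝ E]

/-- The derivative `∂f/∂θ_i` on the torus. -/
noncomputable def angularDeriv (i : Fin N) (f : Torus N → E) (x : Torus N) : E :=
  deriv (fun t : ℝ => f (Function.update x i (x i * Circle.exp t))) 0

/-- The principal arguments of `x` form a lift, and the curve is the image of a straight line
through it, so the chain rule applies. -/
lemma hasDerivAt_update_mul_exp {f : Torus N → E}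
    (hf : ContDiff ℝ 1 fun θ : Fin N → ℝ => f fun i => Circle.exp (θ i)) (x : Torus N)
    (i : Fin N) :
    HasDerivAt (fun t : ℝ => f (Function.update x i (x i * Circle.exp t)))
      (fderiv ℝ (fun θ : Fin N → ℝ => f fun i => Circle.exp (θ i))
        (fun k => Complex.arg (x k)) (Pi.single i 1)) 0 := by
  set θ : Fin N → ℝ := fun k => Complex.arg (x k) with hθ
  have hcurve : HasDerivAt (fun t : ℝ => θ + t • Pi.single i (1 : ℝ)) (Pi.single i 1) 0 := by
    simpa using ((hasDerivAt_id (0 : ℝ)).smul_const (Pi.single i (1 : ℝ))).const_add θ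
  have hfd := (hf.differentiable one_ne_zero (θ + (0 : ℝ) • Pi.single i (1 : ℝ))).hasFDerivAt
  have h := hfd.comp_hasDerivAt (0 : ℝ) hcurve
  rw [zero_smul, add_zero] at h
  refine h.congr_of_eventuallyEq (.of_forall fun t => congrArg f (funext fun k => ?_))
  rcases eq_or_ne k i with rfl | hk
  · simp [hθ, Circle.exp_add, Circle.exp_arg]
  · simp [hθ, hk, Circle.exp_arg]

/-- `arg` is discontinuous, but its values lie in the compact cube `[-π, π]^N`, on which the
derivative of the lift is bounded. -/
lemma exists_norm_angularDeriv_le {f : Torus N → E}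
    (hf : ContDiff ℝ 1 fun θ : Fin N → ℝ => f fun i => Circle.exp (θ i)) (i : Fin N) :
    ∃ C : ℝ, ∀ x, ‖angularDeriv i f x‖ ≤ C := by
  have hK : IsCompact (Set.Icc (fun _ : Fin N => -Real.pi) fun _ => Real.pi) := isCompact_Icc
  have hcont : Continuous fun θ : Fin N → ℝ =>
      fderiv ℝ (fun θ : Fin N → ℝ => f fun i => Circle.exp (θ i)) θ (Pi.single i 1) :=
    (hf.continuous_fderiv one_ne_zero).clm_apply continuous_const
  obtain ⟨C, hC⟩ := hK.exists_bound_of_continuousOn hcont.continuousOn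
  refine ⟨C, fun x => ?_⟩
  rw [angularDeriv, (hasDerivAt_update_mul_exp hf x i).deriv]
  exact hC _ ⟨fun k => (Complex.neg_pi_lt_arg _).le, fun k => Complex.arg_le_pi _⟩

lemma measurable_angularDeriv [CompleteSpace E] [MeasurableSpace E] [BorelSpace E]
    {f : Torus N → E} (hf : Continuous f) (i : Fin N) : Measurable (angularDeriv i f) := by
  have hcont : Continuous (Function.uncurry fun (x : Torus N) (t : ℝ) =>
      f (Function.update x i (x i * Circle.exp t))) := by
    refine hf.comp (continuous_fst.update i ?_)
    exact ((continuous_apply i).comp continuous_fst).mul (Circle.exp.continuous.comp continuous_snd)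
  exact (measurable_deriv_with_param hcont).comp (measurable_id.prodMk measurable_const)

end AngularDerivative

/-! ### Calculus of bounded pointwise limits, as needed for dominated convergence. -/

section BoundedConvergence

/-- Pointwise convergence of a uniformly bounded sequence of functions. -/
def BoundedTendsto {X E : Type*} [NormedAddCommGroup E] (F : ℕ → X → E) (L : X → E) : Prop :=
  (∃ C : ℝ, ∀ n x, ‖F n x‖ ≤ C) ∧ ∀ x, Tendsto (fun n => F n x) atTop (𝓝 (L x))

variable {X E : Type*} [NormedAddCommGroup E] {F G : ℕ → X → E} {L M : X → E}

lemma BoundedTendsto.add (hF : BoundedTendsto F L) (hG : BoundedTendsto G M) :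
    BoundedTendsto (fun n x => F n x + G n x) fun x => L x + M x := by
  obtain ⟨⟨C, hC⟩, hF⟩ := hF
  obtain ⟨⟨D, hD⟩, hG⟩ := hG
  exact ⟨⟨C + D, fun n x => (norm_add_le _ _).trans (add_le_add (hC n x) (hD n x))⟩,
    fun x => (hF x).add (hG x)⟩

lemma BoundedTendsto.sum {κ : Type*} (s : Finset κ) {F : κ → ℕ → X → E} {L : κ → X → E}
    (h : ∀ k ∈ s, BoundedTendsto (F k) (L k)) :
    BoundedTendsto (fun n x => ∑ k ∈ s, F k n x) fun x => ∑ k ∈ s, L k x := by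
  refine ⟨?_, fun x => tendsto_finsetSum _ fun k hk => (h k hk).2 x⟩
  choose! C hC using fun k hk => (h k hk).1
  exact ⟨∑ k ∈ s, C k, fun n x => norm_sum_le_of_le _ fun k hk => hC k hk n x⟩

lemma BoundedTendsto.const_smul [NormedSpace ℂ E] (c : ℂ) (hF : BoundedTendsto F L) :
    BoundedTendsto (fun n x => c • F n x) fun x => c • L x := by
  obtain ⟨⟨C, hC⟩, hF⟩ := hF
  refine ⟨⟨‖c‖ * C, fun n x => ?_⟩, fun x => (hF x).const_smul c⟩
  rw [norm_smul]
  exact mul_le_mul_of_nonneg_left (hC n x) (norm_nonneg _)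

lemma BoundedTendsto.smul_const [NormedSpace ℂ E] {φ : ℕ → X → ℂ} {l : X → ℂ}
    (hF : BoundedTendsto φ l) (v : E) :
    BoundedTendsto (fun n x => φ n x • v) fun x => l x • v := by
  obtain ⟨⟨C, hC⟩, hF⟩ := hF
  refine ⟨⟨C * ‖v‖, fun n x => ?_⟩, fun x => (hF x).smul_const v⟩
  rw [norm_smul]
  exact mul_le_mul_of_nonneg_right (hC n x) (norm_nonneg _)

end BoundedConvergence

/-! ### The spikes on the circle. -/

section CircleFunctions

/-- `1 - cos` as a function on the circle. -/
noncomputable def versine (z : Circle) : ℝ := 1 - (z : ℂ).re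

/-- The odd functions `sin / (1 + n (1 - cos))` on the circle: they converge uniformly to `0`,
while their derivatives are uniformly bounded and equal to `1` at `z = 1`. -/
noncomputable def spike (n : ℕ) (z : Circle) : ℝ := (z : ℂ).im / (1 + n * versine z)

lemma re_sq_add_im_sq (z : Circle) : (z : ℂ).re ^ 2 + (z : ℂ).im ^ 2 = 1 := by
  have h := z.normSq_coe
  rw [Complex.normSq_apply] at h
  linarith

lemma versine_nonneg (z : Circle) : 0 ≤ versine z := by
  have := re_sq_add_im_sq z
  unfold versine
  nlinarith [sq_nonneg (z : ℂ).im]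

/-- This is `sin² = (1 - cos)(1 + cos) ≤ 2 (1 - cos)`; it controls the second term of `spikeDeriv`
uniformly in `n`. -/
lemma im_sq_le_versine (z : Circle) : (z : ℂ).im ^ 2 ≤ 2 * versine z := by
  have := re_sq_add_im_sq z
  unfold versine
  nlinarith [sq_nonneg ((z : ℂ).re - 1)]

lemma versine_eq_zero_iff {z : Circle} : versine z = 0 ↔ z = 1 := by
  refine ⟨fun h => ?_, fun h => by simp [h, versine]⟩
  have h1 := im_sq_le_versine z
  rw [h, mul_zero] at h1
  have him : (z : ℂ).im = 0 := by nlinarith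
  refine Circle.ext (Complex.ext ?_ (by simpa using him))
  unfold versine at h
  simp
  linarith

lemma versine_inv (z : Circle) : versine z⁻¹ = versine z := by
  simp [versine]

lemma spike_inv (n : ℕ) (z : Circle) : spike n z⁻¹ = -spike n z := by
  simp [spike, versine_inv, neg_div]

@[simp] lemma spike_one (n : ℕ) : spike n 1 = 0 := by simp [spike]

lemma one_le_spike_denom (n : ℕ) (z : Circle) : 1 ≤ 1 + n * versine z := by
  have := mul_nonneg n.cast_nonneg (versine_nonneg z)
  linarith

lemma abs_spike_le (n : ℕ) (z : Circle) : |spike n z| ≤ |(z : ℂ).im| := by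
  rw [spike, abs_div, abs_of_pos (zero_lt_one.trans_le (one_le_spike_denom n z))]
  exact div_le_self (abs_nonneg _) (one_le_spike_denom n z)

lemma abs_spike_le_one (n : ℕ) (z : Circle) : |spike n z| ≤ 1 :=
  (abs_spike_le n z).trans ((Complex.abs_im_le_norm _).trans_eq z.norm_coe)

lemma norm_coe_sub_coe (x y : Circle) : ‖(x : ℂ) - y‖ = ‖((x / y : Circle) : ℂ) - 1‖ := by
  have h : (x : ℂ) - y = (((x / y : Circle) : ℂ) - 1) * y := by
    rw [sub_mul, ← Circle.coe_mul, div_mul_cancel, one_mul]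
  rw [h, norm_mul, Circle.norm_coe, mul_one]

/-- A Lipschitz bound uniform in `n`: it cancels the pole of the divided difference across `x_i =
x_j`. -/
lemma abs_spike_div_le (n : ℕ) (x y : Circle) : |spike n (x / y)| ≤ ‖(x : ℂ) - y‖ := by
  rw [norm_coe_sub_coe]
  refine (abs_spike_le n _).trans ?_
  simpa using Complex.abs_im_le_norm (((x / y : Circle) : ℂ) - 1)

lemma versine_div_le (x y : Circle) : versine (x / y) ≤ ‖(x : ℂ) - y‖ := by
  rw [norm_coe_sub_coe, norm_sub_rev]
  simpa [versine] using Complex.re_le_norm (1 - ((x / y : Circle) : ℂ))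

lemma tendsto_spike_denom {z : Circle} (hz : z ≠ 1) :
    Tendsto (fun n : ℕ => 1 + (n : ℝ) * versine z) atTop atTop := by
  have hc : 0 < versine z := (versine_nonneg z).lt_of_ne' (mt versine_eq_zero_iff.1 hz)
  exact tendsto_atTop_add_const_left _ _ (tendsto_natCast_atTop_atTop.atTop_mul_const hc)

lemma tendsto_spike (z : Circle) : Tendsto (fun n => spike n z) atTop (𝓝 0) := by
  rcases eq_or_ne z 1 with rfl | hz
  · simp
  · exact tendsto_const_nhds.div_atTop (tendsto_spike_denom hz)

/-- The derivative of `spike n` along the circle. -/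
noncomputable def spikeDeriv (n : ℕ) (z : Circle) : ℝ :=
  (z : ℂ).re / (1 + n * versine z) - n * (z : ℂ).im ^ 2 / (1 + n * versine z) ^ 2

lemma hasDerivAt_spike (n : ℕ) (z : Circle) :
    HasDerivAt (fun t : ℝ => spike n (z * Circle.exp t)) (spikeDeriv n z) 0 := by
  have hre : HasDerivAt (fun t : ℝ => ((z * Circle.exp t : Circle) : ℂ).re) (-(z : ℂ).im) 0 := by
    have h : (fun t : ℝ => ((z * Circle.exp t : Circle) : ℂ).re) =
        fun t => (z : ℂ).re * Real.cos t - (z : ℂ).im * Real.sin t := by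
      ext t
      simp [Complex.mul_re, Circle.coe_exp, Complex.exp_ofReal_mul_I_re, Complex.exp_ofReal_mul_I_im]
    rw [h]
    exact (((Real.hasDerivAt_cos 0).const_mul (z : ℂ).re).fun_sub
      ((Real.hasDerivAt_sin 0).const_mul (z : ℂ).im)).congr_deriv (by simp)
  have him : HasDerivAt (fun t : ℝ => ((z * Circle.exp t : Circle) : ℂ).im) (z : ℂ).re 0 := by
    have h : (fun t : ℝ => ((z * Circle.exp t : Circle) : ℂ).im) =
        fun t => (z : ℂ).re * Real.sin t + (z : ℂ).im * Real.cos t := by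
      ext t
      simp [Complex.mul_im, Circle.coe_exp, Complex.exp_ofReal_mul_I_re, Complex.exp_ofReal_mul_I_im]
    rw [h]
    exact (((Real.hasDerivAt_sin 0).const_mul (z : ℂ).re).fun_add
      ((Real.hasDerivAt_cos 0).const_mul (z : ℂ).im)).congr_deriv (by simp)
  have hden := ((hre.const_sub 1).const_mul (n : ℝ)).const_add 1
  have hpos := zero_lt_one.trans_le (one_le_spike_denom n z)
  have hne : 1 + (n : ℝ) * (1 - ((z * Circle.exp 0 : Circle) : ℂ).re) ≠ 0 := by
    simpa [versine] using hpos.ne'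
  have h := him.div hden hne
  refine h.congr_deriv ?_
  simp only [Circle.exp_zero, mul_one, spikeDeriv]
  unfold versine at *
  field_simp

lemma spikeDeriv_one (n : ℕ) : spikeDeriv n 1 = 1 := by simp [spikeDeriv, versine]

/-- With `D = 1 + n (1 - cos) ≥ 1`, the first term is at most `1`, and `n sin² ≤ 2D ≤ 2D²` bounds
the second by `2`. -/
lemma abs_spikeDeriv_le (n : ℕ) (z : Circle) : |spikeDeriv n z| ≤ 3 := by
  have h1 := one_le_spike_denom n z
  set D := 1 + (n : ℝ) * versine z with hD
  have hre : |(z : ℂ).re / D| ≤ 1 := by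
    rw [abs_div, abs_of_pos (by linarith : 0 < D)]
    exact (div_le_self (abs_nonneg _) h1).trans
      ((Complex.abs_re_le_norm _).trans_eq z.norm_coe)
  have him : |(n : ℝ) * (z : ℂ).im ^ 2 / D ^ 2| ≤ 2 := by
    rw [abs_of_nonneg (by positivity), div_le_iff₀ (by positivity)]
    have := mul_le_mul_of_nonneg_left (im_sq_le_versine z) (n.cast_nonneg (α := ℝ))
    nlinarith
  calc |spikeDeriv n z| ≤ |(z : ℂ).re / D| + |(n : ℝ) * (z : ℂ).im ^ 2 / D ^ 2| := abs_sub _ _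
    _ ≤ 3 := by linarith

lemma tendsto_spikeDeriv {z : Circle} (hz : z ≠ 1) :
    Tendsto (fun n => spikeDeriv n z) atTop (𝓝 0) := by
  have h := tendsto_spike_denom hz
  have hre : Tendsto (fun n : ℕ => (z : ℂ).re / (1 + n * versine z)) atTop (𝓝 0) :=
    tendsto_const_nhds.div_atTop h
  have him : Tendsto (fun n : ℕ => (n : ℝ) * (z : ℂ).im ^ 2 / (1 + n * versine z) ^ 2) atTop
      (𝓝 0) := by
    refine squeeze_zero (fun n => by positivity) (fun n => ?_)
      (tendsto_const_nhds.div_atTop h : Tendsto (fun n : ℕ => 2 / (1 + n * versine z)) _ _)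
    have h1 := one_le_spike_denom n z
    rw [div_le_div_iff₀ (by positivity) (by positivity)]
    have := mul_le_mul_of_nonneg_left (im_sq_le_versine z) (n.cast_nonneg (α := ℝ))
    have h2 : (n : ℝ) * (z : ℂ).im ^ 2 ≤ 2 * (1 + n * versine z) := by linarith
    nlinarith [mul_le_mul_of_nonneg_right h2 (by linarith : 0 ≤ 1 + (n : ℝ) * versine z)]
  simpa [spikeDeriv] using hre.sub him

lemma versine_exp (t : ℝ) : versine (Circle.exp t) = 1 - Real.cos t := by
  simp [versine, Circle.coe_exp, Complex.exp_ofReal_mul_I_re]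

lemma spike_exp (n : ℕ) (t : ℝ) :
    spike n (Circle.exp t) = Real.sin t / (1 + n * (1 - Real.cos t)) := by
  simp [spike, versine_exp, Circle.coe_exp, Complex.exp_ofReal_mul_I_im]

lemma continuous_versine : Continuous versine := by
  unfold versine
  fun_prop

lemma continuous_spike (n : ℕ) : Continuous (spike n) := by
  unfold spike
  refine Continuous.div (by fun_prop) ?_ fun z => (zero_lt_one.trans_le (one_le_spike_denom n z)).ne'
  exact continuous_const.add (continuous_const.mul continuous_versine)

end CircleFunctions

end JackTorus


namespace JackTorus

open MeasureTheory Filter Topology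

/-! ### The weighted bumps attached to one mirror. -/

section TestFunctions

variable {N : ℕ}

/-- A nonnegative smooth function on the torus which vanishes to second order on every mirror
`x_k = x_l` other than `x_i = x_j`, and nowhere else. -/
noncomputable def mirrorWeight (i j : Fin N) (x : Torus N) : ℝ :=
  ∏ p : Fin N × Fin N with p.1 ≠ p.2 ∧ s(p.1, p.2) ≠ s(i, j), versine (x p.1 / x p.2)

lemma mirrorWeight_nonneg (i j : Fin N) (x : Torus N) : 0 ≤ mirrorWeight i j x :=
  Finset.prod_nonneg fun _ _ => versine_nonneg _

lemma mirrorWeight_ne_zero_iff {i j : Fin N} {x : Torus N} :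
    mirrorWeight i j x ≠ 0 ↔ ∀ k l : Fin N, k ≠ l → s(k, l) ≠ s(i, j) → x k ≠ x l := by
  simp [mirrorWeight, Finset.prod_ne_zero_iff, versine_eq_zero_iff, div_eq_one]

lemma continuous_mirrorWeight (i j : Fin N) : Continuous (mirrorWeight i j) :=
  continuous_finsetProd _ fun p _ =>
    continuous_versine.comp ((continuous_apply p.1).div' (continuous_apply p.2))

lemma contDiff_mirrorWeight (i j : Fin N) :
    ContDiff ℝ 1 fun θ : Fin N → ℝ => mirrorWeight i j fun k => Circle.exp (θ k) := by
  unfold mirrorWeight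
  simp_rw [← Circle.exp_sub, versine_exp]
  fun_prop

lemma exists_mirrorWeight_le (i j : Fin N) : ∃ C : ℝ, ∀ x, mirrorWeight i j x ≤ C := by
  obtain ⟨C, hC⟩ := isCompact_univ.exists_bound_of_continuousOn
    (continuous_mirrorWeight i j).continuousOn
  exact ⟨C, fun x => (le_abs_self _).trans (hC x trivial)⟩

/-- The factor of the pair `(k, l)` supplies the distance; compactness bounds the product of the
others. -/
lemma exists_mirrorWeight_le_mul_norm_sub {i j k l : Fin N} (hkl : k ≠ l)
    (h : s(k, l) ≠ s(i, j)) :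
    ∃ C : ℝ, ∀ x, mirrorWeight i j x ≤ C * ‖(x k : ℂ) - x l‖ := by
  set s : Finset (Fin N × Fin N) := {p | p.1 ≠ p.2 ∧ s(p.1, p.2) ≠ s(i, j)} with hs
  have hmem : (k, l) ∈ s := by simp [hs, hkl, -Sym2.eq, h]
  have hcont : Continuous fun x : Torus N => ∏ p ∈ s.erase (k, l), versine (x p.1 / x p.2) :=
    continuous_finsetProd _ fun p _ =>
      continuous_versine.comp ((continuous_apply p.1).div' (continuous_apply p.2))
  obtain ⟨C, hC⟩ := isCompact_univ.exists_bound_of_continuousOn hcont.continuousOn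
  refine ⟨C, fun x => ?_⟩
  rw [mirrorWeight, ← hs, ← Finset.mul_prod_erase s _ hmem, mul_comm]
  exact mul_le_mul ((le_abs_self _).trans (hC x trivial)) (versine_div_le _ _) (versine_nonneg _)
    ((norm_nonneg _).trans (hC x trivial))

/-- Smooth functions converging to `0` whose normal derivative on the mirror `x_i = x_j` stays
fixed. -/
noncomputable def mirrorBump (i j : Fin N) (n : ℕ) (x : Torus N) : ℝ :=
  mirrorWeight i j x * spike n (x i / x j)

lemma continuous_mirrorBump (i j : Fin N) (n : ℕ) : Continuous (mirrorBump i j n) :=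
  (continuous_mirrorWeight i j).mul
    ((continuous_spike n).comp ((continuous_apply i).div' (continuous_apply j)))

lemma contDiff_mirrorBump (i j : Fin N) (n : ℕ) :
    ContDiff ℝ 1 fun θ : Fin N → ℝ => mirrorBump i j n fun k => Circle.exp (θ k) := by
  unfold mirrorBump
  refine (contDiff_mirrorWeight i j).mul ?_
  simp_rw [← Circle.exp_sub, spike_exp]
  refine ContDiff.div (by fun_prop) (by fun_prop) fun θ => ?_
  have := one_le_spike_denom n (Circle.exp (θ i - θ j))
  rw [versine_exp] at this
  exact (zero_lt_one.trans_le this).ne'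

lemma angularDeriv_mirrorBump {i j k : Fin N} {n : ℕ} {x : Torus N} {c : ℝ}
    (hc : HasDerivAt (fun t : ℝ => spike n (Function.update x k (x k * Circle.exp t) i /
      Function.update x k (x k * Circle.exp t) j)) c 0) :
    angularDeriv k (mirrorBump i j n) x =
      angularDeriv k (mirrorWeight i j) x * spike n (x i / x j) + mirrorWeight i j x * c := by
  have hW := hasDerivAt_update_mul_exp (contDiff_mirrorWeight i j) x k
  have hW' := hW.congr_deriv hW.deriv.symm
  simpa [angularDeriv, mirrorBump] using (hW'.fun_mul hc).deriv

lemma angularDeriv_left_mirrorBump {i j : Fin N} (hij : i ≠ j) (n : ℕ) (x : Torus N) :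
    angularDeriv i (mirrorBump i j n) x =
      angularDeriv i (mirrorWeight i j) x * spike n (x i / x j) +
        mirrorWeight i j x * spikeDeriv n (x i / x j) := by
  refine angularDeriv_mirrorBump ?_
  simpa [hij.symm, mul_div_right_comm] using hasDerivAt_spike n (x i / x j)

lemma angularDeriv_right_mirrorBump {i j : Fin N} (hij : i ≠ j) (n : ℕ) (x : Torus N) :
    angularDeriv j (mirrorBump i j n) x =
      angularDeriv j (mirrorWeight i j) x * spike n (x i / x j) +
        mirrorWeight i j x * -spikeDeriv n (x j / x i) := by
  refine angularDeriv_mirrorBump ?_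
  -- Moving `x j` rotates `x i / x j` backwards; oddness of the spike rewrites it as a forward
  -- rotation of `x j / x i`.
  have h := (hasDerivAt_spike n (x j / x i)).fun_neg
  refine h.congr_of_eventuallyEq (.of_forall fun t => ?_)
  simp only [Function.update_self, Function.update_of_ne hij, ← spike_inv]
  rw [mul_inv, inv_div, div_mul_eq_div_div, div_eq_mul_inv (x i / x j)]

lemma angularDeriv_other_mirrorBump {i j k : Fin N} (hki : k ≠ i) (hkj : k ≠ j) (n : ℕ)
    (x : Torus N) :
    angularDeriv k (mirrorBump i j n) x =
      angularDeriv k (mirrorWeight i j) x * spike n (x i / x j) := by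
  rw [angularDeriv_mirrorBump (c := 0), mul_zero, add_zero]
  simpa [hki.symm, hkj.symm] using hasDerivAt_const (0 : ℝ) (spike n (x i / x j))

end TestFunctions

/-! ### Reduction of the Dunkl operator on `φ • v` to scalar divided differences. -/

section DividedDifferences

variable {N : ℕ} {ι : Type*} [Fintype ι]

open Classical in
/-- The divided difference of a real function on the torus, with its limit value on the mirror. -/
noncomputable def scalarDividedDiff (i j : Fin N) (φ : Torus N → ℝ) (x : Torus N) : ℂ :=
  if x i = x j then -Complex.I * (angularDeriv i φ x - angularDeriv j φ x : ℝ)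
  else ((x i : ℂ) / ((x i : ℂ) - (x j : ℂ))) * (φ x - φ (x ∘ Equiv.swap i j) : ℝ)

lemma eulerDeriv_smul {φ : Torus N → ℝ}
    (hφ : ContDiff ℝ 1 fun θ : Fin N → ℝ => φ fun i => Circle.exp (θ i)) (v : ι → ℂ) (i : Fin N)
    (x : Torus N) :
    eulerDeriv i (fun y => (φ y : ℂ) • v) x = (-Complex.I * ((angularDeriv i φ x : ℝ) : ℂ)) • v := by
  have h := hasDerivAt_update_mul_exp hφ x i
  rw [eulerDeriv, (h.ofReal_comp.smul_const v).deriv, angularDeriv, h.deriv, smul_smul]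

lemma dividedDiff_smul {φ : Torus N → ℝ}
    (hφ : ContDiff ℝ 1 fun θ : Fin N → ℝ => φ fun i => Circle.exp (θ i)) (v : ι → ℂ)
    (i j : Fin N) (x : Torus N) :
    dividedDiff i j (fun y => (φ y : ℂ) • v) x = scalarDividedDiff i j φ x • v := by
  unfold dividedDiff scalarDividedDiff
  split_ifs
  · rw [eulerDeriv_smul hφ, eulerDeriv_smul hφ, ← sub_smul, Complex.ofReal_sub, mul_sub]
  · rw [← sub_smul, smul_smul, Complex.ofReal_sub]

lemma xDunkl_smul [DecidableEq ι] (τ : Equiv.Perm (Fin N) →* Matrix.orthogonalGroup ι ℝ) (κ : ℝ)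
    (i : Fin N) {φ : Torus N → ℝ}
    (hφ : ContDiff ℝ 1 fun θ : Fin N → ℝ => φ fun i => Circle.exp (θ i)) (v : ι → ℂ)
    (x : Torus N) :
    xDunkl τ κ i (fun y => (φ y : ℂ) • v) x =
      (-Complex.I * ((angularDeriv i φ x : ℝ) : ℂ)) • v +
        (κ : ℂ) • ∑ j ∈ Finset.univ.erase i,
          scalarDividedDiff i j φ x • (repMatrix τ (Equiv.swap i j)).mulVec v := by
  simp only [xDunkl, eulerDeriv_smul hφ, dividedDiff_smul hφ, Matrix.mulVec_smul]

/-- This makes one side of the symmetry relation vanish when tested against constants. -/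
lemma xDunkl_const [DecidableEq ι] (τ : Equiv.Perm (Fin N) →* Matrix.orthogonalGroup ι ℝ) (κ : ℝ)
    (i : Fin N) (v : ι → ℂ) : xDunkl τ κ i (fun _ => v) = 0 := by
  ext1 x
  simp [xDunkl, eulerDeriv, dividedDiff]

lemma measurable_scalarDividedDiff (i j : Fin N) {φ : Torus N → ℝ} (hφ : Continuous φ) :
    Measurable (scalarDividedDiff i j φ) := by
  classical
  have hc (k : Fin N) : Measurable fun x : Torus N => (x k : ℂ) :=
    (by fun_prop : Continuous fun x : Torus N => (x k : ℂ)).measurable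
  have hswap : Continuous fun x : Torus N => x ∘ Equiv.swap i j :=
    continuous_pi fun k => continuous_apply (Equiv.swap i j k)
  have hs : Measurable fun x : Torus N => φ (x ∘ Equiv.swap i j) := (hφ.comp hswap).measurable
  refine Measurable.ite (p := fun x : Torus N => x i = x j)
    (isClosed_eq (continuous_apply i) (continuous_apply j)).measurableSet ?_ ?_
  · exact (Complex.measurable_ofReal.comp
      ((measurable_angularDeriv hφ i).sub (measurable_angularDeriv hφ j))).const_mul _
  · exact ((hc i).div ((hc i).sub (hc j))).mul (Complex.measurable_ofReal.comp (hφ.measurable.sub hs))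

lemma measurable_xDunkl_smul [DecidableEq ι]
    (τ : Equiv.Perm (Fin N) →* Matrix.orthogonalGroup ι ℝ) (κ : ℝ)
    (i : Fin N) {φ : Torus N → ℝ} (hφ : Continuous φ)
    (hφ' : ContDiff ℝ 1 fun θ : Fin N → ℝ => φ fun i => Circle.exp (θ i)) (v : ι → ℂ) :
    Measurable (xDunkl τ κ i fun y => (φ y : ℂ) • v) := by
  rw [funext (xDunkl_smul τ κ i hφ' v)]
  refine Measurable.add ?_ ((Finset.measurable_fun_sum _ fun j _ => ?_).const_smul (κ : ℂ))
  · exact ((Complex.measurable_ofReal.comp (measurable_angularDeriv hφ i)).const_mul _).smul_const v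
  · exact (measurable_scalarDividedDiff i j hφ).smul_const _

end DividedDifferences

/-! ### Bounded limits of the Dunkl operator on the bumps. -/

section Limits

variable {N : ℕ} {i j : Fin N}

open Classical in
lemma boundedTendsto_angularDeriv_mirrorBump (hij : i ≠ j) :
    BoundedTendsto (fun n x => -Complex.I * ((angularDeriv i (mirrorBump i j n) x : ℝ) : ℂ))
      fun x => if x i = x j then -Complex.I * mirrorWeight i j x else 0 := by
  obtain ⟨A, hA⟩ := exists_norm_angularDeriv_le (contDiff_mirrorWeight i j) i
  obtain ⟨B, hB⟩ := exists_mirrorWeight_le i j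
  refine ⟨⟨A * 1 + B * 3, fun n x => ?_⟩, fun x => ?_⟩
  · have hA0 : 0 ≤ A := (norm_nonneg _).trans (hA x)
    have hB0 : 0 ≤ B := (mirrorWeight_nonneg i j x).trans (hB x)
    rw [norm_mul, norm_neg, Complex.norm_I, one_mul, Complex.norm_real,
      angularDeriv_left_mirrorBump hij]
    refine (norm_add_le _ _).trans (add_le_add ?_ ?_) <;> rw [norm_mul]
    · exact mul_le_mul (hA x) (abs_spike_le_one n _) (norm_nonneg _) hA0
    · rw [Real.norm_of_nonneg (mirrorWeight_nonneg i j x)]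
      exact mul_le_mul (hB x) (abs_spikeDeriv_le n _) (norm_nonneg _) hB0
  · simp_rw [angularDeriv_left_mirrorBump hij]
    split_ifs with h
    · simp [h, spikeDeriv_one]
    · have h1 : x i / x j ≠ 1 := by rwa [Ne, div_eq_one]
      have := ((tendsto_spike (x i / x j)).const_mul (angularDeriv i (mirrorWeight i j) x)).add
        ((tendsto_spikeDeriv h1).const_mul (mirrorWeight i j x))
      have := ((Complex.continuous_ofReal.tendsto _).comp this).const_mul (-Complex.I)
      simpa using this

lemma mirrorWeight_comp_swap_le (x : Torus N) {B : ℝ} (k l : Fin N)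
    (hB : ∀ x, mirrorWeight i j x ≤ B * ‖(x k : ℂ) - x l‖) :
    mirrorWeight i j (x ∘ Equiv.swap k l) ≤ B * ‖(x k : ℂ) - x l‖ := by
  simpa [norm_sub_rev] using hB (x ∘ Equiv.swap k l)

lemma tendsto_mirrorBump (x : Torus N) :
    Tendsto (fun n => mirrorBump i j n x) atTop (𝓝 0) := by
  simpa [mirrorBump] using (tendsto_spike (x i / x j)).const_mul (mirrorWeight i j x)

lemma norm_coe_div_mul_le {x y : Circle} (hxy : x ≠ y) {r C : ℝ} (h : |r| ≤ C * ‖(x : ℂ) - y‖) :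
    ‖((x : ℂ) / ((x : ℂ) - (y : ℂ))) * (r : ℂ)‖ ≤ C := by
  have hpos : 0 < ‖(x : ℂ) - y‖ := norm_pos_iff.2 (sub_ne_zero.2 fun h => hxy (Circle.ext h))
  rw [norm_mul, norm_div, Circle.norm_coe, Complex.norm_real, one_div, inv_mul_le_iff₀ hpos,
    mul_comm, Real.norm_eq_abs]
  linarith

lemma tendsto_dividedDiff_mirrorBump_of_ne (k l : Fin N) (x : Torus N) :
    Tendsto (fun n => ((x k : ℂ) / ((x k : ℂ) - (x l : ℂ))) *
      (mirrorBump i j n x - mirrorBump i j n (x ∘ Equiv.swap k l) : ℝ)) atTop (𝓝 0) := by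
  have h := (tendsto_mirrorBump (i := i) (j := j) x).sub
    (tendsto_mirrorBump (i := i) (j := j) (x ∘ Equiv.swap k l))
  have := ((Complex.continuous_ofReal.tendsto _).comp h).const_mul
    ((x k : ℂ) / ((x k : ℂ) - (x l : ℂ)))
  simpa using this

lemma abs_mirrorBump_le (n : ℕ) (x : Torus N) : |mirrorBump i j n x| ≤ mirrorWeight i j x := by
  rw [mirrorBump, abs_mul, abs_of_nonneg (mirrorWeight_nonneg i j x)]
  exact mul_le_of_le_one_right (mirrorWeight_nonneg i j x) (abs_spike_le_one n _)

lemma abs_mirrorBump_le_mul {B : ℝ} (hB : ∀ x, mirrorWeight i j x ≤ B) (n : ℕ) (x : Torus N) :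
    |mirrorBump i j n x| ≤ B * ‖(x i : ℂ) - x j‖ := by
  rw [mirrorBump, abs_mul, abs_of_nonneg (mirrorWeight_nonneg i j x)]
  exact mul_le_mul (hB x) (abs_spike_div_le n _ _) (abs_nonneg _)
    ((mirrorWeight_nonneg i j x).trans (hB x))

open Classical in
-- On the mirror the spike is `0` and its derivatives in `θ_i` and `θ_j` are `1` and `-1`, whence
-- the factor `2` for every `n`. Off the mirror the bumps tend to `0`, and the uniform Lipschitz
-- bound absorbs the denominator.
lemma boundedTendsto_scalarDividedDiff_mirrorBump (hij : i ≠ j) :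
    BoundedTendsto (fun n => scalarDividedDiff i j (mirrorBump i j n))
      fun x => if x i = x j then -Complex.I * (2 * mirrorWeight i j x) else 0 := by
  obtain ⟨B, hB⟩ := exists_mirrorWeight_le i j
  have hval : ∀ n x, x i = x j → scalarDividedDiff i j (mirrorBump i j n) x =
      -Complex.I * (2 * mirrorWeight i j x) := by
    intro n x h
    rw [scalarDividedDiff, if_pos h, angularDeriv_left_mirrorBump hij,
      angularDeriv_right_mirrorBump hij]
    simp [h, spikeDeriv_one, two_mul]
  refine ⟨⟨2 * B, fun n x => ?_⟩, fun x => ?_⟩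
  all_goals beta_reduce
  · by_cases h : x i = x j
    · rw [hval n x h, norm_mul, norm_neg, Complex.norm_I, one_mul, norm_mul, Complex.norm_real,
        Real.norm_of_nonneg (mirrorWeight_nonneg i j x), Complex.norm_two]
      exact mul_le_mul_of_nonneg_left (hB x) zero_le_two
    · rw [scalarDividedDiff, if_neg h]
      refine norm_coe_div_mul_le h ((abs_sub _ _).trans ?_)
      have h1 := abs_mirrorBump_le_mul hB n x
      have h2 := abs_mirrorBump_le_mul hB n (x ∘ Equiv.swap i j)
      simp only [Function.comp_apply, Equiv.swap_apply_left, Equiv.swap_apply_right] at h2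
      rw [norm_sub_rev] at h2
      linarith
  · split_ifs with h
    · simp_rw [hval _ x h]
      exact tendsto_const_nhds
    · simp_rw [scalarDividedDiff, if_neg h]
      exact tendsto_dividedDiff_mirrorBump_of_ne i j x

/-- On `x_i = x_k` the weight vanishes, which removes the derivative of the spike; what remains is
multiplied by the spike itself and tends to `0`. Nearby, the weight is bounded by a multiple of
`|x_i - x_k|`. -/
lemma boundedTendsto_scalarDividedDiff_mirrorBump_of_ne {k : Fin N} (hij : i ≠ j) (hki : k ≠ i)
    (hkj : k ≠ j) :
    BoundedTendsto (fun n => scalarDividedDiff i k (mirrorBump i j n)) fun _ => 0 := by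
  have hpair : s(i, k) ≠ s(i, j) := by simp [hkj, hki]
  obtain ⟨B, hB⟩ := exists_mirrorWeight_le_mul_norm_sub hki.symm hpair
  obtain ⟨A, hA⟩ := exists_norm_angularDeriv_le (contDiff_mirrorWeight i j) i
  obtain ⟨A', hA'⟩ := exists_norm_angularDeriv_le (contDiff_mirrorWeight i j) k
  have hval : ∀ n x, x i = x k → scalarDividedDiff i k (mirrorBump i j n) x =
      -Complex.I * ((angularDeriv i (mirrorWeight i j) x - angularDeriv k (mirrorWeight i j) x) *
        spike n (x i / x j) : ℝ) := by
    intro n x h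
    have h0 : mirrorWeight i j x = 0 := by
      by_contra hne
      exact mirrorWeight_ne_zero_iff.1 hne i k hki.symm hpair h
    rw [scalarDividedDiff, if_pos h, angularDeriv_left_mirrorBump hij,
      angularDeriv_other_mirrorBump hki hkj, h0, zero_mul, add_zero, sub_mul]
  refine ⟨⟨max (A + A') (2 * B), fun n x => ?_⟩, fun x => ?_⟩
  all_goals beta_reduce
  · by_cases h : x i = x k
    · rw [hval n x h, norm_mul, norm_neg, Complex.norm_I, one_mul, Complex.norm_real, norm_mul]
      refine le_max_of_le_left ?_
      refine (mul_le_of_le_one_right (norm_nonneg _) (abs_spike_le_one n _)).trans ?_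
      exact (norm_sub_le _ _).trans (add_le_add (hA x) (hA' x))
    · rw [scalarDividedDiff, if_neg h]
      refine le_max_of_le_right (norm_coe_div_mul_le h ((abs_sub _ _).trans ?_))
      have h1 := (abs_mirrorBump_le n x).trans (hB x)
      have h2 := (abs_mirrorBump_le n _).trans (mirrorWeight_comp_swap_le x i k hB)
      linarith
  · by_cases h : x i = x k
    · simp_rw [hval _ x h]
      have := (tendsto_spike (x i / x j)).const_mul
        (angularDeriv i (mirrorWeight i j) x - angularDeriv k (mirrorWeight i j) x)
      have := ((Complex.continuous_ofReal.tendsto _).comp this).const_mul (-Complex.I)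
      simpa using this
    · simp_rw [scalarDividedDiff, if_neg h]
      exact tendsto_dividedDiff_mirrorBump_of_ne i k x

open Classical in
lemma boundedTendsto_xDunkl_mirrorBump {ι : Type*} [Fintype ι] [DecidableEq ι]
    (τ : Equiv.Perm (Fin N) →* Matrix.orthogonalGroup ι ℝ) (κ : ℝ) (hij : i ≠ j) (v : ι → ℂ) :
    BoundedTendsto (fun n => xDunkl τ κ i fun y => (mirrorBump i j n y : ℂ) • v)
      fun x => (if x i = x j then -Complex.I * mirrorWeight i j x else 0) •
        (v + (2 * κ : ℂ) • (repMatrix τ (Equiv.swap i j)).mulVec v) := by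
  have h := ((boundedTendsto_angularDeriv_mirrorBump hij).smul_const v).add
    ((BoundedTendsto.sum (Finset.univ.erase i)
      (F := fun k n x => scalarDividedDiff i k (mirrorBump i j n) x •
        (repMatrix τ (Equiv.swap i k)).mulVec v)
      -- Only the reflection `(i,j)` survives in the limit; its value, twice that of the plain
      -- derivative, produces `2κ`.
      (L := fun k x => (if k = j then (if x i = x j then
        -Complex.I * (2 * mirrorWeight i j x : ℂ) else 0) else 0) •
        (repMatrix τ (Equiv.swap i k)).mulVec v) fun k hk => ?_).const_smul (κ : ℂ))
  · convert h using 2 with n x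
    · exact funext (xDunkl_smul τ κ i (contDiff_mirrorBump i j n) v)
    simp only [ite_smul, zero_smul, Finset.sum_ite_eq', Finset.mem_erase, Finset.mem_univ,
      hij.symm, ne_eq, not_false_eq_true, and_self, if_true]
    split_ifs
    · rw [smul_add, smul_smul, smul_smul]
      congr 2
      ring
    · simp
  · refine BoundedTendsto.smul_const ?_ _
    rcases eq_or_ne k j with rfl | hkj
    · simpa using boundedTendsto_scalarDividedDiff_mirrorBump hij
    · simpa [hkj] using
        boundedTendsto_scalarDividedDiff_mirrorBump_of_ne hij (Finset.ne_of_mem_erase hk) hkj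

end Limits

end JackTorus


/-! ### Vanishing of the measure on the faces. -/

namespace JackTorus

open MeasureTheory Filter Topology

/-- At least two rows and two columns force `h ≥ 3`, hence `|2κ| < 2/3`. -/
lemma abs_two_mul_lt_one_of_maxHook {d : YoungDiagram} (hrow : 1 < d.rowLen 0)
    (hcol : 1 < d.colLen 0) {κ : ℝ} (hκl : -1 / maxHook d < κ) (hκu : κ < 1 / maxHook d) :
    |2 * κ| < 1 := by
  have h3 : 3 ≤ maxHook d := by
    have h1 : (2 : ℝ) ≤ d.rowLen 0 := by exact_mod_cast hrow
    have h2 : (2 : ℝ) ≤ d.colLen 0 := by exact_mod_cast hcol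
    unfold maxHook
    linarith
  have h : 1 / maxHook d ≤ 1 / 3 := one_div_le_one_div_of_le (by norm_num) h3
  rw [neg_div] at hκl
  rw [abs_lt]
  constructor <;> linarith

lemma repMatrix_mul {N : ℕ} {ι : Type*} [Fintype ι] [DecidableEq ι]
    (τ : Equiv.Perm (Fin N) →* Matrix.orthogonalGroup ι ℝ) (w w' : Equiv.Perm (Fin N)) :
    repMatrix τ (w * w') = repMatrix τ w * repMatrix τ w' := by
  simp only [repMatrix, map_mul, Submonoid.coe_mul]
  exact Matrix.map_mul (f := Complex.ofRealHom)

lemma repMatrix_swap_mul_self {N : ℕ} {ι : Type*} [Fintype ι] [DecidableEq ι]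
    (τ : Equiv.Perm (Fin N) →* Matrix.orthogonalGroup ι ℝ) (i j : Fin N) :
    repMatrix τ (Equiv.swap i j) * repMatrix τ (Equiv.swap i j) = 1 := by
  rw [← repMatrix_mul, Equiv.swap_mul_self]
  simp [repMatrix]

/-- `(1 + c σ)(1 - c σ) = 1 - c²` for the involution `σ = τ((i,j))`. -/
lemma add_smul_swap_mulVec_sub {N : ℕ} {ι : Type*} [Fintype ι] [DecidableEq ι]
    (τ : Equiv.Perm (Fin N) →* Matrix.orthogonalGroup ι ℝ) (i j : Fin N) (c : ℂ) (u : ι → ℂ) :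
    (u - c • (repMatrix τ (Equiv.swap i j)).mulVec u) +
      c • (repMatrix τ (Equiv.swap i j)).mulVec
        (u - c • (repMatrix τ (Equiv.swap i j)).mulVec u) = (1 - c ^ 2) • u := by
  rw [Matrix.mulVec_sub, Matrix.mulVec_smul, Matrix.mulVec_mulVec, repMatrix_swap_mul_self,
    Matrix.one_mulVec, sub_smul, one_smul, smul_sub, smul_smul, sq]
  abel

lemma isC1_const {N : ℕ} {ι : Type*} [Fintype ι] (u : ι → ℂ) :
    IsC1 (fun _ : Torus N => u) := contDiff_const

lemma isC1_smul {N : ℕ} {ι : Type*} [Fintype ι] {φ : Torus N → ℝ}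
    (hφ : ContDiff ℝ 1 fun θ : Fin N → ℝ => φ fun i => Circle.exp (θ i)) (v : ι → ℂ) :
    IsC1 (fun x => (φ x : ℂ) • v) :=
  (Complex.ofRealCLM.contDiff.comp hφ).smul contDiff_const

lemma sesqInt_zero_right {N : ℕ} {ι : Type*} [Fintype ι]
    (μ : VectorMeasure (Torus N) (Matrix ι ι ℂ)) (f : Torus N → (ι → ℂ)) :
    sesqInt μ f 0 = 0 := by
  simp [sesqInt]

/-- Isolates a diagonal entry, where positivity of the measure is available. -/
lemma sesqInt_smul_single {N : ℕ} {ι : Type*} [Fintype ι] [DecidableEq ι]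
    (μ : VectorMeasure (Torus N) (Matrix ι ι ℂ)) (φ : Torus N → ℂ) (a : ι) :
    sesqInt μ (fun x => φ x • Pi.single a 1) (fun _ => Pi.single a 1) =
      (entryMeasure μ a a).integral (fun x => starRingEnd ℂ (φ x))
        (ContinuousLinearMap.mul ℝ ℂ) := by
  rw [sesqInt, Finset.sum_eq_single a, Finset.sum_eq_single a]
  · simp
  · intro b _ hb
    simp [hb]
  · simp
  · intro b _ hb
    simp [hb]
  · simp

/-- The weighted mass of the mirror `x_i = x_j` for each diagonal entry of an orthogonality measure
vanishes. -/
lemma IsOrthogonalityMeasure.setIntegral_mirrorWeight_eq_zero {N : ℕ} {ι : Type*} [Fintype ι]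
    [DecidableEq ι] {τ : Equiv.Perm (Fin N) →* Matrix.orthogonalGroup ι ℝ} {κ : ℝ}
    (hκ : |2 * κ| < 1) {μ : VectorMeasure (Torus N) (Matrix ι ι ℂ)}
    (hμ : IsOrthogonalityMeasure τ κ μ) {i j : Fin N} (hij : i ≠ j) {a : ι}
    {m : Measure (Torus N)} [IsFiniteMeasure m]
    (hm : ∀ B, MeasurableSet B → μ B a a = (m.real B : ℂ)) :
    ∫ x in {x | x i = x j}, mirrorWeight i j x ∂m = 0 := by
  classical
  have hmeas : MeasurableSet {x : Torus N | x i = x j} :=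
    (isClosed_eq (continuous_apply i) (continuous_apply j)).measurableSet
  obtain ⟨B, hB⟩ := exists_mirrorWeight_le i j
  have hint : Integrable (mirrorWeight i j) m :=
    .of_bound (continuous_mirrorWeight i j).measurable.aestronglyMeasurable B
      (.of_forall fun x => by rw [Real.norm_of_nonneg (mirrorWeight_nonneg i j x)]; exact hB x)
  set e : ι → ℂ := Pi.single a 1 with he
  -- Up to the scalar `1 - 4κ²`, this is the preimage of `e` under `1 + 2κ σ`.
  set v : ι → ℂ := e - (2 * κ : ℂ) • (repMatrix τ (Equiv.swap i j)).mulVec e with hv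
  set c : ℂ := -Complex.I * (1 - (2 * κ : ℂ) ^ 2) with hc
  have hc0 : c ≠ 0 := by
    have h1 : (1 : ℝ) - (2 * κ) ^ 2 ≠ 0 := by
      have := (sq_lt_one_iff_abs_lt_one (2 * κ)).2 hκ
      linarith
    refine mul_ne_zero (neg_ne_zero.2 Complex.I_ne_zero) ?_
    exact_mod_cast h1
  have hlim := boundedTendsto_xDunkl_mirrorBump τ κ hij v
  obtain ⟨⟨C, hC⟩, hL⟩ := hlim
  have hzero : ∀ n, sesqInt μ (xDunkl τ κ i fun y => (mirrorBump i j n y : ℂ) • v)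
      (fun _ => e) = 0 := fun n => by
    rw [hμ.symmetric i _ _ (isC1_smul (contDiff_mirrorBump i j n) v) (isC1_const e),
      xDunkl_const, sesqInt_zero_right]
  have hconv := tendsto_sesqInt_const μ e
    (fun n => measurable_xDunkl_smul τ κ i (continuous_mirrorBump i j n)
      (contDiff_mirrorBump i j n) v) hC hL
  simp_rw [hzero] at hconv
  have hval := tendsto_nhds_unique hconv tendsto_const_nhds
  set φ : Torus N → ℝ := Set.indicator {x | x i = x j} (mirrorWeight i j) with hφ
  have hlimit : (fun x : Torus N => (if x i = x j then -Complex.I * mirrorWeight i j x else 0) •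
      (v + (2 * κ : ℂ) • (repMatrix τ (Equiv.swap i j)).mulVec v)) =
      fun x => (c * φ x) • e := by
    ext1 x
    rw [hv, add_smul_swap_mulVec_sub, smul_smul]
    congr 1
    by_cases h : x i = x j
    · simp only [hφ, hc, Set.indicator, Set.mem_ofPred_eq, if_pos h]
      ring
    · simp [hφ, h]
  rw [hlimit, he, sesqInt_smul_single, integral_complexMeasure_eq _ m hm] at hval
  · simp only [map_mul, Complex.conj_ofReal, integral_const_mul] at hval
    rw [integral_complex_ofReal, mul_eq_zero, Complex.ofReal_eq_zero, hφ,
      integral_indicator hmeas] at hval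
    exact hval.resolve_left (by simpa using hc0)
  · simp only [map_mul, Complex.conj_ofReal]
    exact ((hint.indicator hmeas).ofReal).const_mul _

/-- A nonnegative function with zero integral over the mirror vanishes almost everywhere there, yet
the weight is nonzero throughout the face. -/
lemma IsOrthogonalityMeasure.diagonal_measure_face_eq_zero {N : ℕ} {ι : Type*} [Fintype ι]
    [DecidableEq ι] {τ : Equiv.Perm (Fin N) →* Matrix.orthogonalGroup ι ℝ} {κ : ℝ}
    (hκ : |2 * κ| < 1) {μ : VectorMeasure (Torus N) (Matrix ι ι ℂ)}
    (hμ : IsOrthogonalityMeasure τ κ μ) {i j : Fin N} (hij : i ≠ j) {a : ι}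
    {m : Measure (Torus N)} [IsFiniteMeasure m]
    (hm : ∀ B, MeasurableSet B → μ B a a = (m.real B : ℂ)) : m (face i j) = 0 := by
  have hmeas : MeasurableSet {x : Torus N | x i = x j} :=
    (isClosed_eq (continuous_apply i) (continuous_apply j)).measurableSet
  obtain ⟨B, hB⟩ := exists_mirrorWeight_le i j
  have hint : Integrable (mirrorWeight i j) m :=
    .of_bound (continuous_mirrorWeight i j).measurable.aestronglyMeasurable B
      (.of_forall fun x => by rw [Real.norm_of_nonneg (mirrorWeight_nonneg i j x)]; exact hB x)
  have h0 := hμ.setIntegral_mirrorWeight_eq_zero hκ hij hm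
  rw [integral_eq_zero_iff_of_nonneg (mirrorWeight_nonneg i j) hint.integrableOn,
    Filter.EventuallyEq, ae_restrict_iff' hmeas, ae_iff] at h0
  refine measure_mono_null (fun x hx => ?_) h0
  simpa using ⟨hx.1, mirrorWeight_ne_zero_iff.2 hx.2⟩

/-- A positive semidefinite matrix of trace `0` is `0`, so the diagonal measures suffice and the
off-diagonal entries need no separate argument. -/
lemma IsOrthogonalityMeasure.apply_eq_zero_of_subset_iUnion_face {N : ℕ} {ι : Type*} [Fintype ι]
    [DecidableEq ι] {τ : Equiv.Perm (Fin N) →* Matrix.orthogonalGroup ι ℝ} {κ : ℝ}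
    (hκ : |2 * κ| < 1) {μ : VectorMeasure (Torus N) (Matrix ι ι ℂ)}
    (hμ : IsOrthogonalityMeasure τ κ μ) {B : Set (Torus N)} (hB : MeasurableSet B)
    (hsub : B ⊆ ⋃ (i : Fin N) (j : Fin N) (_ : i < j), face i j) : μ B = 0 := by
  rw [← (hμ.pos B hB).trace_eq_zero_iff]
  refine Finset.sum_eq_zero fun a _ => ?_
  obtain ⟨m, hfin, hm⟩ := exists_diagonal_measure μ hμ.pos a
  have h0 : m B = 0 := by
    refine measure_mono_null hsub (measure_iUnion_null fun i => measure_iUnion_null fun j =>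
      measure_iUnion_null fun hij => hμ.diagonal_measure_face_eq_zero hκ hij.ne hm)
  rw [Matrix.diag_apply, hm B hB, Measure.real, h0]
  simp

/-- A point of a mirror with at least `N - 1` distinct coordinates lies on the corresponding
face. -/
lemma mem_face_of_lt_ncard_range {N : ℕ} {x : Torus N} {i j : Fin N} (hij : i ≠ j)
    (hx : x i = x j) (h : N < (Set.range x).ncard + 2) : x ∈ face i j := by
  refine ⟨hx, fun k l hkl hpair hxkl => h.not_ge ?_⟩
  -- Two distinct pairs share at most one index, so one of `k`, `l` lies outside `{i, j}`.
  wlog hk : k ≠ i ∧ k ≠ j generalizing k l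
  · refine this l k hkl.symm (by rwa [Sym2.eq_swap]) hxkl.symm ?_
    simp only [ne_eq, Sym2.eq_iff] at hpair
    grind
  -- Dropping `j` and `k` loses no value: `x j` is attained at `i`, and `x k` at `l`, or at `i` when
  -- `l = j`. Hence at most `N - 2` values occur.
  have hsub : Set.range x ⊆ x '' ((Finset.univ.erase j).erase k : Finset (Fin N)) := by
    rintro _ ⟨p, rfl⟩
    by_cases hpj : p = j
    · exact ⟨i, by simp [hij, hk.1.symm], by rw [hpj, hx]⟩
    by_cases hpk : p = k
    · by_cases hlj : l = j
      · exact ⟨i, by simp [hij, hk.1.symm], by rw [hpk, hxkl, hlj, hx]⟩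
      · exact ⟨l, by simp [hlj, hkl.symm], by rw [hpk, hxkl]⟩
    · exact ⟨p, by simp [hpj, hpk], rfl⟩
  have hcard : ((Finset.univ.erase j).erase k).card + 2 = N := by
    have h1 : (Finset.univ.erase j).card + 1 = N := by
      rw [Finset.card_erase_add_one (Finset.mem_univ j), Finset.card_univ, Fintype.card_fin]
    have h2 := Finset.card_erase_add_one
      (Finset.mem_erase.2 ⟨hk.2, Finset.mem_univ k⟩ : k ∈ Finset.univ.erase j)
    omega
  have h1 := Set.ncard_le_ncard hsub (Set.toFinite _)
  have h2 := Set.ncard_image_le (f := x)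
    (Finset.finite_toSet ((Finset.univ.erase j).erase k : Finset (Fin N)))
  rw [Set.ncard_coe_finset] at h2
  omega

end JackTorus

theorem theorem8p7 (N : ℕ) (d : YoungDiagram) (hrow : 1 < d.rowLen 0) (hcol : 1 < d.colLen 0)
    {ι : Type*} [Fintype ι] [DecidableEq ι]
    (τ : Equiv.Perm (Fin N) →* Matrix.orthogonalGroup ι ℝ) (hτ : JackTorus.IsOfShape τ d)
    (κ : ℝ) (hκl : -1 / JackTorus.maxHook d < κ) (hκu : κ < 1 / JackTorus.maxHook d)
    (μ : MeasureTheory.VectorMeasure (JackTorus.Torus N) (Matrix ι ι ℂ))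
    (hμ : JackTorus.IsOrthogonalityMeasure τ κ μ) :
    (∀ i j : Fin N, i < j →
      (JackTorus.singularPart μ).restrict (JackTorus.face i j) = 0) ∧
    JackTorus.SupportedBy (JackTorus.singularPart μ)
      {x : JackTorus.Torus N | (Set.range x).ncard + 2 ≤ N} := by
  open JackTorus in
  have hκ := abs_two_mul_lt_one_of_maxHook hrow hcol hκl hκu
  refine ⟨fun i j hij => ?_, fun B hB hdisj => ?_⟩
  · ext1 B hB
    rw [MeasureTheory.VectorMeasure.restrict_apply _ (measurableSet_face i j) hB, singularPart,
      MeasureTheory.VectorMeasure.restrict_apply _ (measurableSet_singularSet N)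
        (hB.inter (measurableSet_face i j))]
    refine hμ.apply_eq_zero_of_subset_iUnion_face hκ
      ((hB.inter (measurableSet_face i j)).inter (measurableSet_singularSet N)) fun x hx => ?_
    simp only [Set.mem_iUnion]
    exact ⟨i, j, hij, hx.1.2⟩
  · rw [singularPart,
      MeasureTheory.VectorMeasure.restrict_apply _ (measurableSet_singularSet N) hB]
    refine hμ.apply_eq_zero_of_subset_iUnion_face hκ
      (hB.inter (measurableSet_singularSet N)) fun x hx => ?_
    have hx2 := hx.2
    simp only [singularSet, Set.mem_iUnion] at hx2 ⊢
    obtain ⟨i, j, hij, hxij⟩ := hx2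
    refine ⟨i, j, hij, mem_face_of_lt_ncard_range hij.ne hxij ?_⟩
    by_contra hle
    exact Set.disjoint_left.1 hdisj hx.1 (not_lt.1 hle)
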